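/- Let $G=(V,E)$ be a finite simple graph, let $A\subset V$ and $B = V\setminus A$, and let $|G\rangle=\prod_{\{a,b\}\in E}\mathrm{CZ}_{ab}\,|+\rangle^{\otimes V}$ be the associated graph state, with one qubit for each vertex. Let $G-A$ denote the subgraph of $G$ induced by $B$. For a state $|\psi\rangle$ of $n$ qubits, let $\tau_n(|\psi\rangle)=|\langle\psi|\sigma_y^{\otimes n}|\psi^*\rangle|$, where $|\psi^*\rangle$ is the complex conjugate of $|\psi\rangle$ in the computational basis. Suppose that some vertex in $B$ has no neighbors in $A$ and has even degree in $G-A$. Then every rank-one projective measurement on $A$, local or global, yields only $\tau=0$ states on $B$. That is, for every orthonormal basis $(|\beta_i\rangle)_i$ of the Hilbert space of the qubits in $A$ (an arbitrary basis for a global measurement, a basis of product vectors for a local one), and for every outcome $i$ of positive probability $p_i=\|(\langle\beta_i|_A\otimes I_B)|G\rangle\|^2$, the post-measurement state $|\phi_i\rangle=(\langle\beta_i|_A\otimes I_B)|G\rangle/\sqrt{p_i}$ satisfies $\tau_{|B|}(|\phi_i\rangle)=0$. -/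

import Mathlib

noncomputable section

namespace QState

/-- The Hilbert space of qubits labelled by the finite set `W`. The computational basis vectors
are indexed by the bit assignments `W → Fin 2`. -/
abbrev Qubits (W : Type*) [Fintype W] : Type _ :=
  EuclideanSpace ℂ (W → Fin 2)

/-- The product vector `⨂_w v_w`. -/
def productVector {W : Type*} [Fintype W] (v : W → EuclideanSpace ℂ (Fin 2)) : Qubits W :=
  WithLp.toLp 2 fun x => ∏ w, v w (x w)

/-- The tensor power `M^{⊗ W}` of a single-qubit operator. -/
def tensorPower (W : Type*) [Fintype W] (M : Matrix (Fin 2) (Fin 2) ℂ) :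
    Matrix (W → Fin 2) (W → Fin 2) ℂ :=
  Matrix.of fun x y => ∏ w, M (x w) (y w)

/-! ### The tangle -/

/-- The Pauli matrix `σ_y`. -/
def pauliY : Matrix (Fin 2) (Fin 2) ℂ :=
  !![0, -Complex.I; Complex.I, 0]

/-- Wootters' tilde `σ_y^{⊗ n} |ψ*⟩`, with the complex conjugate taken in the computational
basis. -/
def tilde {W : Type*} [Fintype W] [DecidableEq W] (ψ : Qubits W) : Qubits W :=
  WithLp.toLp 2 (Matrix.mulVec (tensorPower W pauliY) fun x => star (ψ x))

/-- The `n`-tangle `τ_n(ψ) = |⟨ψ|ψ̃⟩|` of a state of the `n` qubits in `W`. -/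
def nTangle {W : Type*} [Fintype W] [DecidableEq W] (ψ : Qubits W) : ℝ :=
  ‖inner ℂ ψ (tilde ψ)‖

/-! ### Graph states -/

/-- The single-qubit state `|+⟩ = (|0⟩ + |1⟩) / √2`. -/
def plus : EuclideanSpace ℂ (Fin 2) :=
  ((Real.sqrt 2)⁻¹ : ℂ) • (EuclideanSpace.single 0 1 + EuclideanSpace.single 1 1)

/-- The controlled-`Z` gate on the qubits `a` and `b`, which multiplies a computational basis
vector by `-1` when both of these qubits are in state `1` and fixes it otherwise. -/
def cz {V : Type*} [Fintype V] (a b : V) : Matrix (V → Fin 2) (V → Fin 2) ℂ :=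
  Matrix.diagonal fun x => if x a = 1 ∧ x b = 1 then -1 else 1

theorem cz_comm {V : Type*} [Fintype V] (a b : V) : cz a b = cz b a := by
  simp only [cz, and_comm]

/-- The controlled-`Z` gate of an unordered pair of qubits. -/
def czEdge {V : Type*} [Fintype V] (e : Sym2 V) : Matrix (V → Fin 2) (V → Fin 2) ℂ :=
  Sym2.lift ⟨cz, cz_comm⟩ e

theorem czEdge_commute {V : Type*} [Fintype V] [DecidableEq V] (e f : Sym2 V) :
    Commute (czEdge e) (czEdge f) := by
  induction e with | _ a b
  induction f with | _ c d
  exact Matrix.commute_diagonal _ _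

theorem czEdge_pairwise_commute {V : Type*} [Fintype V] [DecidableEq V] (s : Set (Sym2 V)) :
    s.Pairwise (Function.onFun Commute czEdge) :=
  fun e _ f _ _ => czEdge_commute e f

/-- The graph state `|G⟩ = ∏_{{a,b} ∈ E} CZ_{ab} |+⟩^{⊗ V}`. -/
def graphState {V : Type*} [Fintype V] [DecidableEq V] (G : SimpleGraph V)
    [DecidableRel G.Adj] : Qubits V :=
  WithLp.toLp 2 (Matrix.mulVec
    (G.edgeFinset.noncommProd czEdge (czEdge_pairwise_commute _))
    (productVector fun _ : V => plus))

/-! ### Rank-one projective measurements of a subset of the qubits -/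

/-- The bit assignment on `V` that restricts to `x` on `A` and to `y` on the complement. -/
def glue {V : Type*} {A : Set V} [DecidablePred (· ∈ A)]
    (x : A → Fin 2) (y : (Aᶜ : Set V) → Fin 2) : V → Fin 2 :=
  fun v => if h : v ∈ A then x ⟨v, h⟩ else y ⟨v, h⟩

/-- The vector `(⟨φ|_A ⊗ I_B) |Ψ⟩`, where `B` is the complement of `A`. -/
def partialInner {V : Type*} [Fintype V] [DecidableEq V] {A : Set V} [DecidablePred (· ∈ A)]
    (φ : Qubits A) (Ψ : Qubits V) : Qubits (Aᶜ : Set V) :=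
  WithLp.toLp 2 fun y => ∑ x : A → Fin 2, star (φ x) * Ψ (glue x y)

/-- The probability `p = ‖(⟨φ|_A ⊗ I_B) |Ψ⟩‖²` of the outcome `|φ⟩⟨φ|` of a measurement of the
qubits in `A`. -/
def outcomeProb {V : Type*} [Fintype V] [DecidableEq V] {A : Set V} [DecidablePred (· ∈ A)]
    (φ : Qubits A) (Ψ : Qubits V) : ℝ :=
  ‖partialInner φ Ψ‖ ^ 2

/-- The state `(⟨φ|_A ⊗ I_B) |Ψ⟩ / √p` of the unmeasured qubits after the outcome `|φ⟩⟨φ|`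
(meaningful when `p > 0`). -/
def postState {V : Type*} [Fintype V] [DecidableEq V] {A : Set V} [DecidablePred (· ∈ A)]
    (φ : Qubits A) (Ψ : Qubits V) : Qubits (Aᶜ : Set V) :=
  ((Real.sqrt (outcomeProb φ Ψ))⁻¹ : ℂ) • partialInner φ Ψ

/-- A rank-one projective measurement, given by an orthonormal basis `β` with measurement operators
`|β_i⟩⟨β_i|`, is local if each of its operators is a tensor product over the individual qubits,
that is, if each `β_i` is a product vector. -/
def IsLocal {W κ : Type*} [Fintype W] [DecidableEq W] [Fintype κ]
    (β : OrthonormalBasis κ ℂ (Qubits W)) : Prop :=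
  ∀ i, ∃ v : W → EuclideanSpace ℂ (Fin 2), β i = productVector v

/-- Every state that the rank-one projective measurement `β` on `A` produces on the remaining
qubits from `Ψ` (with positive probability) is a `τ = 0` state. -/
def YieldsOnlyTauZero {V κ : Type*} [Fintype V] [DecidableEq V] [Fintype κ]
    {A : Set V} [DecidablePred (· ∈ A)]
    (β : OrthonormalBasis κ ℂ (Qubits A)) (Ψ : Qubits V) : Prop :=
  ∀ i, 0 < outcomeProb (β i) Ψ → nTangle (postState (β i) Ψ) = 0

end QState

end

/-!
Local operators act on the tangle through determinants: every `2 × 2` matrix satisfies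
`M σ_y Mᵀ = det M • σ_y`, so replacing `ψ` by `(⨂_w M_w) ψ` multiplies `⟨ψ|ψ̃⟩` by the conjugate of
`∏_w det M_w`. Hence the tangle of a state that is stabilized by a product operator of determinant
different from `1` vanishes. The graph state is stabilized by `X_b ∏_{c ~ b} Z_c`, and when `b` has
no neighbours in `A` this operator is trivial on `A`, so that it survives every measurement of `A`.
Since `det X = det Z = -1`, its determinant product is `(-1) ^ (deg b + 1)`, which is `-1` when the
degree of `b` is even.
-/

namespace QState

open Finset Matrix

section PiKronecker

variable {W R : Type*} [Fintype W] [CommSemiring R] {l m n : W → Type*}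

/-- The tensor product `⨂_w M_w` of a finite family of matrices, with rows and columns indexed by
families of indices. It extends `tensorPower` to factors that vary from qubit to qubit. -/
def piKronecker (M : ∀ w, Matrix (m w) (n w) R) : Matrix (∀ w, m w) (∀ w, n w) R :=
  Matrix.of fun x y => ∏ w, M w (x w) (y w)

theorem piKronecker_apply (M : ∀ w, Matrix (m w) (n w) R) (x : ∀ w, m w) (y : ∀ w, n w) :
    piKronecker M x y = ∏ w, M w (x w) (y w) :=
  rfl

theorem piKronecker_one [∀ w, DecidableEq (m w)] :
    piKronecker (fun w => (1 : Matrix (m w) (m w) R)) = 1 := by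
  ext x y
  simp only [piKronecker_apply, one_apply, Fintype.prod_ite_zero, prod_const_one, funext_iff]

theorem piKronecker_mul [DecidableEq W] [∀ w, Fintype (m w)] (M : ∀ w, Matrix (l w) (m w) R)
    (N : ∀ w, Matrix (m w) (n w) R) :
    piKronecker M * piKronecker N = piKronecker fun w => M w * N w := by
  ext x y
  simp only [mul_apply, piKronecker_apply, Fintype.prod_sum, prod_mul_distrib]

theorem piKronecker_smul (c : W → R) (M : ∀ w, Matrix (m w) (n w) R) :
    piKronecker (fun w => c w • M w) = (∏ w, c w) • piKronecker M := by
  ext x y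
  simp only [piKronecker_apply, Matrix.smul_apply, smul_eq_mul, prod_mul_distrib]

theorem piKronecker_transpose (M : ∀ w, Matrix (m w) (n w) R) :
    (piKronecker M)ᵀ = piKronecker fun w => (M w)ᵀ :=
  rfl

theorem piKronecker_conjTranspose [StarRing R] (M : ∀ w, Matrix (m w) (n w) R) :
    (piKronecker M)ᴴ = piKronecker fun w => (M w)ᴴ := by
  ext x y
  simp only [conjTranspose_apply, piKronecker_apply, star_prod]

theorem piKronecker_mulVec_apply_of_forall_ne [DecidableEq W] [∀ w, Fintype (n w)]
    {M : ∀ w, Matrix (m w) (n w) R} {x : ∀ w, m w} {y : ∀ w, n w}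
    (h : ∀ w j, j ≠ y w → M w (x w) j = 0) (f : (∀ w, n w) → R) :
    (piKronecker M *ᵥ f) x = (∏ w, M w (x w) (y w)) * f y := by
  refine Fintype.sum_eq_single y fun z hz => ?_
  obtain ⟨w, hw⟩ := Function.ne_iff.1 hz
  exact mul_eq_zero_of_left (prod_eq_zero (mem_univ w) (h w _ hw)) _

end PiKronecker

section Tangle

variable {W : Type*} [Fintype W]

theorem tensorPower_eq_piKronecker (M : Matrix (Fin 2) (Fin 2) ℂ) :
    tensorPower W M = piKronecker fun _ => M :=
  rfl

theorem mul_pauliY_mul_transpose (M : Matrix (Fin 2) (Fin 2) ℂ) :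
    M * pauliY * Mᵀ = M.det • pauliY := by
  ext i j
  fin_cases i <;> fin_cases j <;> simp [pauliY, mul_apply, Fin.sum_univ_two, det_fin_two] <;> ring

variable [DecidableEq W]

theorem piKronecker_mul_tensorPower_pauliY_mul_transpose (M : W → Matrix (Fin 2) (Fin 2) ℂ) :
    piKronecker M * tensorPower W pauliY * (piKronecker M)ᵀ =
      (∏ w, (M w).det) • tensorPower W pauliY := by
  simp only [tensorPower_eq_piKronecker, piKronecker_transpose, piKronecker_mul,
    mul_pauliY_mul_transpose, piKronecker_smul]

theorem inner_tilde_eq_dotProduct (ψ : Qubits W) :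
    inner ℂ ψ (tilde ψ) = (tensorPower W pauliY *ᵥ star ψ.ofLp) ⬝ᵥ star ψ.ofLp :=
  EuclideanSpace.inner_eq_star_dotProduct _ _

theorem inner_tilde_of_eq_piKronecker_mulVec (M : W → Matrix (Fin 2) (Fin 2) ℂ) {φ ψ : Qubits W}
    (h : φ.ofLp = piKronecker M *ᵥ ψ.ofLp) :
    inner ℂ φ (tilde φ) = star (∏ w, (M w).det) * inner ℂ ψ (tilde ψ) := by
  set L := (piKronecker M)ᴴ
  set Y := tensorPower W pauliY
  set u := star ψ.ofLp
  have hL : L * Y * Lᵀ = star (∏ w, (M w).det) • Y := by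
    simp only [L, Y, piKronecker_conjTranspose, piKronecker_mul_tensorPower_pauliY_mul_transpose,
      det_conjTranspose, star_prod]
  calc inner ℂ φ (tilde φ) = (Y *ᵥ (u ᵥ* L)) ⬝ᵥ (u ᵥ* L) := by
        rw [inner_tilde_eq_dotProduct, h, star_mulVec]
    _ = (L * Y * Lᵀ) *ᵥ u ⬝ᵥ u := by
        rw [dotProduct_comm, ← dotProduct_mulVec, dotProduct_comm, ← mulVec_transpose,
          mulVec_mulVec, mulVec_mulVec]
    _ = star (∏ w, (M w).det) * inner ℂ ψ (tilde ψ) := by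
        rw [hL, smul_mulVec, smul_dotProduct, smul_eq_mul, inner_tilde_eq_dotProduct]

theorem nTangle_eq_zero_of_piKronecker_mulVec_eq {M : W → Matrix (Fin 2) (Fin 2) ℂ}
    (hM : ∏ w, (M w).det ≠ 1) {ψ : Qubits W} (hψ : piKronecker M *ᵥ ψ.ofLp = ψ.ofLp) :
    nTangle ψ = 0 := by
  have hfix : inner ℂ ψ (tilde ψ) = star (∏ w, (M w).det) * inner ℂ ψ (tilde ψ) :=
    inner_tilde_of_eq_piKronecker_mulVec M hψ.symm
  rw [nTangle, norm_eq_zero]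
  by_contra hne
  have hdet : star (∏ w, (M w).det) = 1 := (right_eq_mul₀ hne).1 hfix
  exact hM (star_injective (hdet.trans (star_one ℂ).symm))

theorem nTangle_smul (c : ℂ) (ψ : Qubits W) : nTangle (c • ψ) = ‖c‖ ^ 2 * nTangle ψ := by
  have htilde : tilde (c • ψ) = star c • tilde ψ := by
    ext x
    simp [tilde, mulVec, dotProduct, mul_sum, mul_left_comm]
  rw [nTangle, htilde, inner_smul_left, inner_smul_right, norm_mul, norm_mul, nTangle]
  simp only [RCLike.norm_conj, norm_star, sq, mul_assoc]

end Tangle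

section PartialInner

variable {V : Type*} {A : Set V} [DecidablePred (· ∈ A)]

theorem glue_coe (x : A → Fin 2) (y : (Aᶜ : Set V) → Fin 2) (a : A) : glue x y a = x a :=
  dif_pos a.2

theorem glue_coe_compl (x : A → Fin 2) (y : (Aᶜ : Set V) → Fin 2) (b : (Aᶜ : Set V)) :
    glue x y b = y b :=
  dif_neg b.2

variable [Fintype V]

theorem piKronecker_glue {R : Type*} [CommSemiring R] (M : V → Matrix (Fin 2) (Fin 2) R)
    (x x' : A → Fin 2) (y y' : (Aᶜ : Set V) → Fin 2) :
    piKronecker M (glue x y) (glue x' y') =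
      piKronecker (fun a : A => M a) x x' * piKronecker (fun b : (Aᶜ : Set V) => M b) y y' := by
  simp only [piKronecker_apply]
  rw [← Fintype.prod_subtype_mul_prod_subtype (· ∈ A)]
  congr 1
  · exact Fintype.prod_congr _ _ fun a : A => by rw [glue_coe, glue_coe]
  · exact Fintype.prod_congr _ _ fun b : (Aᶜ : Set V) => by rw [glue_coe_compl, glue_coe_compl]

variable [DecidableEq V]

theorem sum_glue {S : Type*} [AddCommMonoid S] (f : (V → Fin 2) → S) :
    ∑ z, f z = ∑ x : A → Fin 2, ∑ y : (Aᶜ : Set V) → Fin 2, f (glue x y) := by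
  rw [← Fintype.sum_prod_type']
  exact ((Equiv.piEquivPiSubtypeProd (· ∈ A) fun _ => Fin 2).symm.sum_comp f).symm

theorem partialInner_piKronecker_mulVec (M : V → Matrix (Fin 2) (Fin 2) ℂ) (φ : Qubits A)
    (Ψ : Qubits V) :
    (partialInner φ (WithLp.toLp 2 (piKronecker M *ᵥ Ψ.ofLp))).ofLp =
      piKronecker (fun b : (Aᶜ : Set V) => M b) *ᵥ
        (partialInner (WithLp.toLp 2 ((piKronecker fun a : A => M a)ᴴ *ᵥ φ.ofLp)) Ψ).ofLp := by
  ext y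
  simp only [partialInner, mulVec, dotProduct, sum_glue (A := A), piKronecker_glue,
    conjTranspose_apply, star_sum, star_mul', star_star, mul_sum, sum_mul]
  rw [sum_comm, sum_comm (s := (univ : Finset ((Aᶜ : Set V) → Fin 2)))]
  refine Fintype.sum_congr _ _ fun x' => ?_
  rw [sum_comm]
  refine Fintype.sum_congr _ _ fun y' => Fintype.sum_congr _ _ fun x => ?_
  ring

theorem piKronecker_mulVec_partialInner_of_mulVec_eq {M : V → Matrix (Fin 2) (Fin 2) ℂ}
    (hA : ∀ a ∈ A, M a = 1) {Ψ : Qubits V} (hΨ : piKronecker M *ᵥ Ψ.ofLp = Ψ.ofLp)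
    (φ : Qubits A) :
    piKronecker (fun b : (Aᶜ : Set V) => M b) *ᵥ (partialInner φ Ψ).ofLp =
      (partialInner φ Ψ).ofLp := by
  have hone : (piKronecker fun a : A => M a) = 1 := by
    simp only [hA _ (Subtype.prop _), piKronecker_one]
  simpa [hone, hΨ] using (partialInner_piKronecker_mulVec M φ Ψ).symm

end PartialInner

section GraphState

/-- The Pauli matrix `σ_x`. -/
def pauliX : Matrix (Fin 2) (Fin 2) ℂ :=
  !![0, 1; 1, 0]

/-- The Pauli matrix `σ_z`. -/
def pauliZ : Matrix (Fin 2) (Fin 2) ℂ :=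
  !![1, 0; 0, -1]

/-- The phase by which the controlled-`Z` gate of an edge multiplies the computational basis
vector `x`. -/
def czPhase {V : Type*} (x : V → Fin 2) : Sym2 V → ℂ :=
  Sym2.lift ⟨fun a b => if x a = 1 ∧ x b = 1 then -1 else 1, fun a b => by simp only [and_comm]⟩

/-- The tensor factors of the stabilizer generator `X_b ∏_{c ~ b} Z_c` of the graph state. -/
def stabilizerGenerator {V : Type*} [DecidableEq V] (G : SimpleGraph V) [DecidableRel G.Adj]
    (b v : V) : Matrix (Fin 2) (Fin 2) ℂ :=
  if v = b then pauliX else if G.Adj b v then pauliZ else 1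

theorem pauliX_apply_add_one (i : Fin 2) : pauliX i (i + 1) = 1 := by
  fin_cases i <;> simp [pauliX]

theorem pauliX_apply_of_ne {i j : Fin 2} (h : j ≠ i + 1) : pauliX i j = 0 := by
  fin_cases i <;> fin_cases j <;> simp_all [pauliX]

theorem pauliZ_apply_of_ne {i j : Fin 2} (h : i ≠ j) : pauliZ i j = 0 := by
  fin_cases i <;> fin_cases j <;> simp_all [pauliZ]

theorem pauliZ_apply_self_mul_self (i : Fin 2) : pauliZ i i * pauliZ i i = 1 := by
  fin_cases i <;> simp [pauliZ]

theorem stabilizerGenerator_of_ne_of_not_adj {V : Type*} [DecidableEq V] {G : SimpleGraph V}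
    [DecidableRel G.Adj] {b v : V} (hne : v ≠ b) (hadj : ¬ G.Adj b v) :
    stabilizerGenerator G b v = 1 := by
  rw [stabilizerGenerator, if_neg hne, if_neg hadj]

theorem stabilizerGenerator_induce {V : Type*} [DecidableEq V] (G : SimpleGraph V)
    [DecidableRel G.Adj] (s : Set V) (b : s) :
    stabilizerGenerator (G.induce s) b = fun v : s => stabilizerGenerator G b v := by
  funext v
  simp only [stabilizerGenerator, SimpleGraph.induce_adj, Subtype.ext_iff]

theorem czEdge_eq_diagonal {V : Type*} [Fintype V] (e : Sym2 V) :
    czEdge e = diagonal fun x => czPhase x e := by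
  induction e with | _ a b
  rfl

theorem czPhase_add_single_of_notMem {V : Type*} [DecidableEq V] {b : V} {e : Sym2 V} (hb : b ∉ e)
    (x : V → Fin 2) (i : Fin 2) : czPhase (x + Pi.single b i) e = czPhase x e := by
  induction e with | _ c d
  simp only [Sym2.mem_iff, not_or] at hb
  simp [czPhase, Pi.single_eq_of_ne' hb.1, Pi.single_eq_of_ne' hb.2]

theorem czPhase_add_single {V : Type*} [DecidableEq V] {b c : V} (hc : c ≠ b) (x : V → Fin 2) :
    czPhase (x + Pi.single b 1) s(b, c) = pauliZ (x c) (x c) * czPhase x s(b, c) := by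
  simp only [czPhase, Sym2.lift_mk, Pi.add_apply, Pi.single_eq_same, Pi.single_eq_of_ne hc,
    add_zero]
  generalize x b = i
  generalize x c = j
  fin_cases i <;> fin_cases j <;> simp [pauliZ]

theorem prod_incidenceFinset {V S : Type*} [DecidableEq V] [CommMonoid S] (G : SimpleGraph V)
    (b : V) [Fintype (G.neighborSet b)] (f : Sym2 V → S) :
    ∏ e ∈ G.incidenceFinset b, f e = ∏ c ∈ G.neighborFinset b, f s(b, c) := by
  symm
  refine prod_bij (fun c _ => s(b, c)) ?_ (fun c _ d _ h => Sym2.congr_right.1 h) ?_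
    fun _ _ => rfl
  · intro c hc
    simpa using hc
  · intro e he
    obtain ⟨hadj, c, rfl⟩ := (G.mem_incidenceFinset b e).1 he
    exact ⟨c, (G.mem_neighborFinset b c).2 hadj, rfl⟩

variable {V : Type*} [Fintype V] [DecidableEq V]

theorem noncommProd_czEdge (s : Finset (Sym2 V)) :
    s.noncommProd czEdge (czEdge_pairwise_commute _) =
      diagonal fun x => ∏ e ∈ s, czPhase x e := by
  induction s using Finset.induction_on with
  | empty => simp
  | insert e s he ih =>
    rw [noncommProd_insert_of_notMem _ _ _ _ he, ih, czEdge_eq_diagonal, diagonal_mul_diagonal]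
    simp only [prod_insert he]

theorem plus_apply (i : Fin 2) : plus i = ((Real.sqrt 2)⁻¹ : ℂ) := by
  fin_cases i <;> simp [plus]

variable (G : SimpleGraph V) [DecidableRel G.Adj]

theorem graphState_apply (x : V → Fin 2) :
    graphState G x =
      (∏ e ∈ G.edgeFinset, czPhase x e) * ((Real.sqrt 2)⁻¹ : ℂ) ^ Fintype.card V := by
  simp [graphState, noncommProd_czEdge, mulVec_diagonal, productVector, plus_apply]

theorem prod_czPhase_add_single (b : V) (x : V → Fin 2) :
    ∏ e ∈ G.edgeFinset, czPhase (x + Pi.single b 1) e =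
      (∏ c ∈ G.neighborFinset b, pauliZ (x c) (x c)) * ∏ e ∈ G.edgeFinset, czPhase x e := by
  have hincident : ∏ e ∈ G.incidenceFinset b, czPhase (x + Pi.single b 1) e =
      (∏ c ∈ G.neighborFinset b, pauliZ (x c) (x c)) * ∏ e ∈ G.incidenceFinset b, czPhase x e := by
    rw [prod_incidenceFinset, prod_incidenceFinset, ← prod_mul_distrib]
    exact prod_congr rfl fun c hc =>
      czPhase_add_single ((G.mem_neighborFinset b c).1 hc).ne' x
  have hother : ∏ e ∈ G.edgeFinset with b ∉ e, czPhase (x + Pi.single b 1) e =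
      ∏ e ∈ G.edgeFinset with b ∉ e, czPhase x e :=
    prod_congr rfl fun e he => czPhase_add_single_of_notMem (mem_filter.1 he).2 x 1
  simp only [← prod_filter_mul_prod_filter_not G.edgeFinset (b ∈ ·),
    ← G.incidenceFinset_eq_filter, hincident, hother, mul_assoc]

theorem stabilizerGenerator_mulVec_apply (b : V) (f : (V → Fin 2) → ℂ) (x : V → Fin 2) :
    (piKronecker (stabilizerGenerator G b) *ᵥ f) x =
      (∏ c ∈ G.neighborFinset b, pauliZ (x c) (x c)) * f (x + Pi.single b 1) := by
  have hentry (v : V) : stabilizerGenerator G b v (x v) ((x + Pi.single b 1 : V → Fin 2) v) =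
      if v ∈ G.neighborFinset b then pauliZ (x v) (x v) else 1 := by
    by_cases hv : v = b
    · subst hv
      simp [stabilizerGenerator, pauliX_apply_add_one]
    · have hx : (x + Pi.single b 1 : V → Fin 2) v = x v := by simp [hv]
      rw [hx]
      by_cases hadj : G.Adj b v <;> simp [stabilizerGenerator, hv, hadj]
  have hzero (v : V) (j : Fin 2) (hj : j ≠ (x + Pi.single b 1 : V → Fin 2) v) :
      stabilizerGenerator G b v (x v) j = 0 := by
    by_cases hv : v = b
    · subst hv
      simpa [stabilizerGenerator] using pauliX_apply_of_ne (by simpa using hj)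
    · have hj' : x v ≠ j := by simpa [hv, eq_comm] using hj
      by_cases hadj : G.Adj b v <;> simp [stabilizerGenerator, hv, hadj, hj', pauliZ_apply_of_ne]
  rw [piKronecker_mulVec_apply_of_forall_ne hzero, Fintype.prod_congr _ _ hentry,
    Fintype.prod_ite_mem]

theorem stabilizerGenerator_mulVec_graphState (b : V) :
    piKronecker (stabilizerGenerator G b) *ᵥ (graphState G).ofLp = (graphState G).ofLp := by
  ext x
  have hsq : (∏ c ∈ G.neighborFinset b, pauliZ (x c) (x c)) *
      ∏ c ∈ G.neighborFinset b, pauliZ (x c) (x c) = 1 := by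
    rw [← prod_mul_distrib]
    exact prod_eq_one fun c _ => pauliZ_apply_self_mul_self (x c)
  rw [stabilizerGenerator_mulVec_apply, graphState_apply, graphState_apply,
    prod_czPhase_add_single]
  simp only [← mul_assoc, hsq, one_mul]

theorem prod_det_stabilizerGenerator (b : V) :
    ∏ v, (stabilizerGenerator G b v).det = (-1) ^ (G.degree b + 1) := by
  have hdet (v : V) : (stabilizerGenerator G b v).det =
      (if v ∈ G.neighborFinset b then -1 else 1) * if v = b then -1 else 1 := by
    by_cases hv : v = b
    · subst hv
      simp [stabilizerGenerator, pauliX]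
    · by_cases hadj : G.Adj b v <;> simp [stabilizerGenerator, hv, hadj, pauliZ]
  rw [Fintype.prod_congr _ _ hdet, prod_mul_distrib, Fintype.prod_ite_mem, prod_const,
    Fintype.prod_ite_eq', G.card_neighborFinset_eq_degree, pow_succ]

end GraphState

end QState

theorem mainTheorem10_general {V : Type*} [Fintype V] [DecidableEq V]
    (G : SimpleGraph V) [DecidableRel G.Adj] (A : Set V) [DecidablePred (· ∈ A)]
    (h : ∃ b : (Aᶜ : Set V), (∀ a ∈ A, ¬ G.Adj b a) ∧ Even ((G.induce Aᶜ).degree b))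
    (φ : QState.Qubits A) :
    QState.nTangle (QState.partialInner φ (QState.graphState G)) = 0 := by
  obtain ⟨b, hb, hdeg⟩ := h
  have hA : ∀ a ∈ A, QState.stabilizerGenerator G b a = 1 := fun a ha =>
    QState.stabilizerGenerator_of_ne_of_not_adj (fun hab => b.2 (hab ▸ ha)) (hb a ha)
  have hdet : ∏ v, (QState.stabilizerGenerator (G.induce Aᶜ) b v).det ≠ 1 := by
    rw [QState.prod_det_stabilizerGenerator, hdeg.add_one.neg_one_pow]
    norm_num
  refine QState.nTangle_eq_zero_of_piKronecker_mulVec_eq hdet ?_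
  rw [QState.stabilizerGenerator_induce]
  exact QState.piKronecker_mulVec_partialInner_of_mulVec_eq hA
    (QState.stabilizerGenerator_mulVec_graphState G b) φ

theorem mainTheorem10 {V κ : Type*} [Fintype V] [DecidableEq V] [Fintype κ]
    (G : SimpleGraph V) [DecidableRel G.Adj] (A : Set V) [DecidablePred (· ∈ A)]
    (h : ∃ b : (Aᶜ : Set V), (∀ a ∈ A, ¬ G.Adj b a) ∧ Even ((G.induce Aᶜ).degree b)) :
    (∀ β : OrthonormalBasis κ ℂ (QState.Qubits A),
      QState.YieldsOnlyTauZero β (QState.graphState G)) ∧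
    (∀ β : OrthonormalBasis κ ℂ (QState.Qubits A), QState.IsLocal β →
      QState.YieldsOnlyTauZero β (QState.graphState G)) := by
  have hβ (β : OrthonormalBasis κ ℂ (QState.Qubits A)) :
      QState.YieldsOnlyTauZero β (QState.graphState G) := fun i _ => by
    rw [QState.postState, QState.nTangle_smul, mainTheorem10_general G A h, mul_zero]
  exact ⟨hβ, fun β _ => hβ β⟩
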